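/- Let $n>3$ and let $(S_k)_{k\ge 0}$ be the random walk on the diagonal lattice in $\mathbb{Z}^n$: $S_0=0$ and the increments $S_{k+1}-S_k$ are independent and uniformly distributed on the $2^n$ vectors $(\pm1,\dots,\pm1)$. For $u=(u_1,\dots,u_n)\in\mathbb{Z}^n$ let $F_{(0,\dots,0)}(u)$ be the expected number of times $k\ge 0$ with $S_k=u$. For $(\lambda_1,\dots,\lambda_{n-1})\in[0,\pi]^{n-1}$ with $\prod_{k=1}^{n-1}\cos\lambda_k\neq 0$ let $\lambda_n\in\mathbb{C}$ be any solution with $\operatorname{Re}\lambda_n\ge 0$ of $$\cosh\lambda_n\,\prod_{k=1}^{n-1}\cos\lambda_k=1 .$$ (When the product is negative, $\lambda_n$ is not real. The remaining choice, at almost every point that of an integer multiple of $2\pi i$, does not affect the integrals below, and the points where the product is $0$ form a null set.) Then for every $u\in\mathbb{Z}^n$ the number $F_{(0,\dots,0)}(u)$ is finite, the following integral converges absolutely, and $$F_{(0,\dots,0)}(u_1,\dots,u_n)=\frac{1}{\pi^{n-1}}\int_{[0,\pi]^{n-1}}\frac{\prod_{k=1}^{n-1}\cos(u_k\lambda_k)\;e^{-|u_n|\lambda_n}}{\tanh\lambda_n}\,d\lambda_1\cdots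 d\lambda_{n-1}.$$ Moreover, the probability that the walk returns to its starting point, i.e. that $S_k=0$ for some $k\ge1$, equals $1-\frac1F$, where $$F=F_{(0,\dots,0)}(0,\dots,0)=\frac{1}{\pi^{n-1}}\int_{[0,\pi]^{n-1}}\frac{1}{\tanh\lambda_n}\,d\lambda_1\cdots d\lambda_{n-1}.$$ -/

import Mathlib

open MeasureTheory ProbabilityTheory
open scoped ENNReal

noncomputable section

/-- The `2 ^ n` steps `(±1, …, ±1)` of the diagonal lattice walk on `ℤⁿ`. -/
def diagonalSteps (n : ℕ) : Finset (Fin n → ℤ) :=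
  Fintype.piFinset fun _ => {-1, 1}

/-- `S` is (a realization on the probability space `(Ω, μ)` of) the random walk on the diagonal
lattice in `ℤⁿ` started at the origin: its increments are independent and each of them is
uniformly distributed on the steps `(±1, …, ±1)`. -/
structure IsDiagonalWalk {Ω : Type*} [MeasurableSpace Ω] (n : ℕ) (μ : Measure Ω)
    (S : ℕ → Ω → Fin n → ℤ) : Prop where
  start : ∀ᵐ ω ∂μ, S 0 ω = 0
  indep : iIndepFun (fun (k : ℕ) (ω : Ω) => S (k + 1) ω - S k ω) μ
  law : ∀ k : ℕ, HasLaw (fun ω => S (k + 1) ω - S k ω)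
    (uniformOn (diagonalSteps n : Set (Fin n → ℤ))) μ

/-- The expected number of times `k = 0, 1, 2, …` at which the walk is at `u`
(every such time is followed by a departure from `u`). -/
def expectedVisits {Ω : Type*} [MeasurableSpace Ω] {n : ℕ} (μ : Measure Ω)
    (S : ℕ → Ω → Fin n → ℤ) (u : Fin n → ℤ) : ℝ≥0∞ :=
  ∫⁻ ω, ∑' k : ℕ, (if S k ω = u then 1 else 0) ∂μ

/-- The event that the walk is again at the origin at some time `k ≥ 1`. -/
def returnEvent {Ω : Type*} {n : ℕ} (S : ℕ → Ω → Fin n → ℤ) : Set Ω :=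
  {ω | ∃ k : ℕ, 1 ≤ k ∧ S k ω = 0}

/-- The cube `[0, π] ^ d`. -/
def piCube (d : ℕ) : Set (Fin d → ℝ) :=
  Set.Icc 0 (fun _ => Real.pi)

/-- `Λ` gives a solution `λ_n = Λ (λ_1, …, λ_d)`, with nonnegative real part, of the equation
`cosh λ_n * ∏ k, cos λ_k = 1` at all points of the cube where it has a solution, that is, where
the product of cosines is not zero. If the product is negative then `λ_n` is not real; its
imaginary part is then an odd multiple of `π`. -/
def IsDispersionSolution (d : ℕ) (Λ : (Fin d → ℝ) → ℂ) : Prop :=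
  ∀ x ∈ piCube d, ∏ k, Real.cos (x k) ≠ 0 →
    0 ≤ (Λ x).re ∧ Complex.cosh (Λ x) * ∏ k, Complex.cos (x k) = 1

/-- The integrand `∏ k, cos (u_k λ_k) * exp (-|u_n| λ_n) / tanh λ_n`, where `n = d + 1` and
`λ_n = Λ (λ_1, …, λ_d)`. -/
def visitIntegrand {d : ℕ} (Λ : (Fin d → ℝ) → ℂ) (u : Fin (d + 1) → ℤ) (x : Fin d → ℝ) : ℂ :=
  (∏ k : Fin d, Complex.cos (u k.castSucc * x k)) *
    Complex.exp (-(|u (Fin.last d)| : ℤ) * Λ x) / Complex.tanh (Λ x)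

/-- The walk exists. -/
theorem exists_isDiagonalWalk (n : ℕ) :
    ∃ (Ω : Type) (_ : MeasurableSpace Ω) (μ : Measure Ω) (S : ℕ → Ω → Fin n → ℤ),
      IsProbabilityMeasure μ ∧ IsDiagonalWalk n μ S := by
  have hne : (diagonalSteps n : Set (Fin n → ℤ)).Nonempty :=
    ⟨fun _ => 1, by simp [diagonalSteps]⟩
  have := isProbabilityMeasure_uniformOn (diagonalSteps n).finite_toSet hne
  obtain ⟨Ω, m, P, X, -, hX, hi, hP⟩ :=
    exists_iid ℕ (uniformOn (diagonalSteps n : Set (Fin n → ℤ)))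
  have key : ∀ k : ℕ, (fun ω => (∑ i ∈ Finset.range (k + 1), X i ω) -
      ∑ i ∈ Finset.range k, X i ω) = X k := by
    intro k; funext ω; simp [Finset.sum_range_succ]
  refine ⟨Ω, m, P, fun k ω => ∑ i ∈ Finset.range k, X i ω, hP, ?_, ?_, ?_⟩
  · simp
  · have e : (fun (k : ℕ) (ω : Ω) => (∑ i ∈ Finset.range (k + 1), X i ω) -
        ∑ i ∈ Finset.range k, X i ω) = X := funext key
    rw [e]
    exact hi
  · intro k
    simpa only [key] using hX k

/-- The function `Λ` exists. -/
theorem exists_isDispersionSolution (d : ℕ) : ∃ Λ, IsDispersionSolution d Λ := by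
  have h : ∀ p : ℂ, ∃ z : ℂ, p ≠ 0 → 0 ≤ z.re ∧ Complex.cosh z * p = 1 := by
    intro p
    by_cases hp : p = 0
    · exact ⟨0, fun h => absurd hp h⟩
    obtain ⟨w, hw⟩ := Complex.cos_surjective p⁻¹
    have hc : Complex.cosh (w * Complex.I) = p⁻¹ := by rw [Complex.cosh_mul_I, hw]
    rcases le_total 0 (w * Complex.I).re with h0 | h0
    · exact ⟨w * Complex.I, fun _ => ⟨h0, by rw [hc, inv_mul_cancel₀ hp]⟩⟩
    · refine ⟨-(w * Complex.I), fun _ => ⟨by rw [Complex.neg_re]; linarith, ?_⟩⟩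
      rw [Complex.cosh_neg, hc, inv_mul_cancel₀ hp]
  choose g hg using h
  refine ⟨fun x => g (∏ k, Complex.cos (x k)), fun x _ hx => hg _ ?_⟩
  have : (∏ k, Complex.cos (x k)) = ((∏ k, Real.cos (x k) : ℝ) : ℂ) := by push_cast; rfl
  rw [this]
  exact_mod_cast hx

end

/-! The coordinates of the walk are independent simple walks on `ℤ`, so `P(S_k = u) = ∏ p_k(u_j)`
with `p_k = simpleWalkProb k`. Fourier inversion gives `p_k(m) = (1/π) ∫ cos^k t cos(mt) dt` over
`[0, π]`. It is applied to the first `n - 1` coordinates only; the sum over `k` is then taken inside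
the integral. With `p = ∏ cos λ_j` and `s = √(1 - p²)`, `∑ p^k p_k(m) = (p/(1+s))^|m| / s`
(`hasSum_pow_mul_simpleWalkProb`), and `cosh λ_n = 1/p` means `e^{-λ_n} = p/(1+s)`, `tanh λ_n = s`.

The interchange is justified by absolute convergence: each coordinate contributes a factor `a_k`,
the mean of `|cos|^k`, and `a_k² ≤ 2/(k+1)`, so `∑ a_k^n` converges for `n ≥ 4`.

For the return probability, finite expectation makes a last visit to the origin exist almost surely.
The walk restarts independently after time `k`, so summing over the time of the last visit gives `1
= F · P(no return)` (`tsum_measure_mul_measure_avoid_eq_one`). -/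

/-! ### Fourier representation of the simple walk on `ℤ` -/

/-- The probability that the simple random walk on `ℤ` is at `m` at time `k`. -/
noncomputable def simpleWalkProb : ℕ → ℤ → ℝ
  | 0, m => if m = 0 then 1 else 0
  | k + 1, m => (simpleWalkProb k (m - 1) + simpleWalkProb k (m + 1)) / 2

theorem simpleWalkProb_nonneg (k : ℕ) (m : ℤ) : 0 ≤ simpleWalkProb k m := by
  induction k generalizing m with
  | zero => unfold simpleWalkProb; split_ifs <;> norm_num
  | succ k ih => unfold simpleWalkProb; linarith [ih (m - 1), ih (m + 1)]

theorem simpleWalkProb_le_one (k : ℕ) (m : ℤ) : simpleWalkProb k m ≤ 1 := by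
  induction k generalizing m with
  | zero => unfold simpleWalkProb; split_ifs <;> norm_num
  | succ k ih => unfold simpleWalkProb; linarith [ih (m - 1), ih (m + 1)]

theorem intervalIntegrable_cos_pow_mul_cos (k : ℕ) (m : ℤ) (a b : ℝ) :
    IntervalIntegrable (fun t => Real.cos t ^ k * Real.cos (m * t)) volume a b :=
  Continuous.intervalIntegrable (by fun_prop) a b

theorem integral_cos_int_mul (m : ℤ) :
    ∫ t in (0 : ℝ)..Real.pi, Real.cos (m * t) = if m = 0 then Real.pi else 0 := by
  split_ifs with h
  · simp [h]
  · have hm : (m : ℝ) ≠ 0 := by exact_mod_cast h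
    rw [intervalIntegral.integral_comp_mul_left Real.cos hm]
    simp [Real.sin_int_mul_pi]

/-- The product-to-sum formula for `cos t * cos (m t)` is the one-step recurrence of the walk. -/
theorem integral_cos_pow_mul_cos (k : ℕ) (m : ℤ) :
    ∫ t in (0 : ℝ)..Real.pi, Real.cos t ^ k * Real.cos (m * t) =
      Real.pi * simpleWalkProb k m := by
  induction k generalizing m with
  | zero =>
    simp only [pow_zero, one_mul, integral_cos_int_mul, simpleWalkProb]
    split_ifs <;> simp
  | succ k ih =>
    have h : ∀ t : ℝ, Real.cos t ^ (k + 1) * Real.cos (m * t) =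
        (Real.cos t ^ k * Real.cos ((m - 1 : ℤ) * t) +
          Real.cos t ^ k * Real.cos ((m + 1 : ℤ) * t)) / 2 := by
      intro t
      push_cast
      rw [sub_mul, add_mul, one_mul, Real.cos_sub, Real.cos_add]
      ring
    simp_rw [h]
    rw [intervalIntegral.integral_div, intervalIntegral.integral_add
      (intervalIntegrable_cos_pow_mul_cos _ _ _ _) (intervalIntegrable_cos_pow_mul_cos _ _ _ _),
      ih, ih]
    simp only [simpleWalkProb]
    ring

/-! ### Decay of the moments of `|cos|` -/

/-- The mean of `|cos| ^ k` over `[0, π]`. -/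
noncomputable def absCosMoment (k : ℕ) : ℝ :=
  (∫ t in (0 : ℝ)..Real.pi, |Real.cos t| ^ k) / Real.pi

theorem intervalIntegrable_abs_cos_pow (k : ℕ) (a b : ℝ) :
    IntervalIntegrable (fun t => |Real.cos t| ^ k) volume a b :=
  Continuous.intervalIntegrable (by fun_prop) a b

theorem absCosMoment_nonneg (k : ℕ) : 0 ≤ absCosMoment k :=
  div_nonneg (intervalIntegral.integral_nonneg Real.pi_pos.le fun _ _ => by positivity)
    Real.pi_pos.le

theorem antitone_absCosMoment : Antitone absCosMoment := by
  intro j k h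
  unfold absCosMoment
  gcongr ?_ / Real.pi
  refine intervalIntegral.integral_mono Real.pi_pos.le (intervalIntegrable_abs_cos_pow _ _ _)
    (intervalIntegrable_abs_cos_pow _ _ _) fun t => ?_
  exact pow_le_pow_of_le_one (abs_nonneg _) (Real.abs_cos_le_one t) h

theorem absCosMoment_zero : absCosMoment 0 = 1 := by
  simp [absCosMoment, Real.pi_ne_zero]

theorem absCosMoment_le_one (k : ℕ) : absCosMoment k ≤ 1 :=
  absCosMoment_zero ▸ antitone_absCosMoment k.zero_le

theorem absCosMoment_even_succ (k : ℕ) :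
    absCosMoment (2 * (k + 1)) = (2 * k + 1) / (2 * k + 2) * absCosMoment (2 * k) := by
  have h : ∀ j, ∫ t in (0 : ℝ)..Real.pi, |Real.cos t| ^ (2 * j) =
      ∫ t in (0 : ℝ)..Real.pi, Real.cos t ^ (2 * j) := by
    intro j
    simp [pow_mul, sq_abs]
  unfold absCosMoment
  rw [h, h, show 2 * (k + 1) = 2 * k + 2 by ring, integral_cos_pow]
  simp
  ring

/-- Wallis-type estimate: the induction closes because `(2k+1)(2k+3) ≤ (2k+2)²`. -/
theorem sq_absCosMoment_even_le (k : ℕ) : absCosMoment (2 * k) ^ 2 ≤ 1 / (2 * k + 1) := by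
  induction k with
  | zero => simp [absCosMoment_zero]
  | succ k ih =>
    rw [absCosMoment_even_succ, mul_pow]
    calc _ ≤ ((2 * k + 1) / (2 * k + 2) : ℝ) ^ 2 * (1 / (2 * k + 1)) := by gcongr
      _ ≤ _ := by
        push_cast
        rw [div_pow, div_mul_div_comm, div_le_div_iff₀ (by positivity) (by positivity)]
        have : (0 : ℝ) ≤ k := k.cast_nonneg
        nlinarith [mul_nonneg this this]

/-- Rounding `k` down to an even exponent costs at most the factor 2. -/
theorem sq_absCosMoment_le (k : ℕ) : absCosMoment k ^ 2 ≤ 2 / (k + 1) := by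
  have h0 : (0 : ℝ) ≤ (k / 2 : ℕ) := Nat.cast_nonneg _
  have h1 : (k : ℝ) ≤ 2 * (k / 2 : ℕ) + 1 := by
    exact_mod_cast (by omega : k ≤ 2 * (k / 2) + 1)
  calc absCosMoment k ^ 2 ≤ absCosMoment (2 * (k / 2)) ^ 2 := by
        gcongr
        · exact absCosMoment_nonneg k
        · exact antitone_absCosMoment (by omega)
    _ ≤ _ := sq_absCosMoment_even_le _
    _ ≤ _ := by
        rw [div_le_div_iff₀ (by positivity) (by positivity)]
        linarith

/-- Each pair of factors is `O(1/k)`, so four factors already give comparison with `∑ 1/k²`. -/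
theorem summable_absCosMoment_pow {n : ℕ} (hn : 3 < n) :
    Summable fun k => absCosMoment k ^ n := by
  have hs : Summable fun k : ℕ => 4 * (1 / ((k + 1 : ℕ) : ℝ) ^ 2) :=
    ((summable_nat_add_iff 1).2 (Real.summable_one_div_nat_pow.2 one_lt_two)).mul_left 4
  refine Summable.of_nonneg_of_le (fun k => pow_nonneg (absCosMoment_nonneg k) n) (fun k => ?_) hs
  calc absCosMoment k ^ n ≤ absCosMoment k ^ 4 :=
        pow_le_pow_of_le_one (absCosMoment_nonneg k) (absCosMoment_le_one k) hn
    _ = (absCosMoment k ^ 2) ^ 2 := by ring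
    _ ≤ (2 / (k + 1)) ^ 2 := by gcongr; exact sq_absCosMoment_le k
    _ = _ := by push_cast; field_simp; norm_num

theorem integral_abs_cos_pow_mul_cos_le (k : ℕ) (m : ℤ) :
    ∫ t in (0 : ℝ)..Real.pi, |Real.cos t ^ k * Real.cos (m * t)| ≤
      Real.pi * absCosMoment k := by
  rw [absCosMoment, mul_div_cancel₀ _ Real.pi_ne_zero]
  refine intervalIntegral.integral_mono Real.pi_pos.le
    (intervalIntegrable_cos_pow_mul_cos k m _ _).abs
    (intervalIntegrable_abs_cos_pow _ _ _) fun t => ?_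
  simp only [abs_mul, abs_pow]
  exact mul_le_of_le_one_right (by positivity) (Real.abs_cos_le_one _)

theorem simpleWalkProb_le_absCosMoment (k : ℕ) (m : ℤ) :
    simpleWalkProb k m ≤ absCosMoment k := by
  refine le_of_mul_le_mul_left ?_ Real.pi_pos
  rw [← integral_cos_pow_mul_cos]
  refine le_trans ?_ (integral_abs_cos_pow_mul_cos_le k m)
  exact intervalIntegral.integral_mono Real.pi_pos.le (intervalIntegrable_cos_pow_mul_cos k m _ _)
    (intervalIntegrable_cos_pow_mul_cos k m _ _).abs fun t => le_abs_self _

/-! ### Generating function in time and the dispersion relation -/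

/-- Each use of the recurrence improves a uniform bound by the factor `|p| < 1`. This gives
uniqueness of bounded solutions of the inhomogeneous recurrence for the generating function. -/
theorem eq_zero_of_bounded_of_recurrence {p B : ℝ} (hp : |p| < 1) {D : ℤ → ℝ}
    (hB : ∀ m, |D m| ≤ B) (hD : ∀ m, D m = p / 2 * (D (m - 1) + D (m + 1))) (m : ℤ) :
    D m = 0 := by
  have h : ∀ (k : ℕ) (m : ℤ), |D m| ≤ |p| ^ k * B := by
    intro k
    induction k with
    | zero => simpa using hB
    | succ k ih =>
      intro m
      rw [hD m, abs_mul, abs_div, abs_two]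
      have h3 := abs_add_le (D (m - 1)) (D (m + 1))
      calc _ ≤ |p| / 2 * (|p| ^ k * B + |p| ^ k * B) := by
            gcongr
            exact h3.trans (add_le_add (ih _) (ih _))
        _ = _ := by ring
  have ht := (tendsto_pow_atTop_nhds_zero_of_lt_one (abs_nonneg p) hp).mul_const B
  rw [zero_mul] at ht
  exact abs_nonpos_iff.1 (ge_of_tendsto' ht fun k => h k m)

theorem summable_pow_mul_simpleWalkProb {p : ℝ} (hp : |p| < 1) (m : ℤ) :
    Summable fun k => p ^ k * simpleWalkProb k m := by
  refine Summable.of_norm_bounded (summable_geometric_of_lt_one (abs_nonneg p) hp) fun k => ?_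
  rw [norm_mul, norm_pow, Real.norm_eq_abs, Real.norm_of_nonneg (simpleWalkProb_nonneg k m)]
  exact mul_le_of_le_one_right (by positivity) (simpleWalkProb_le_one k m)

/-- The generating function of the return probabilities of the simple random walk on `ℤ`. -/
theorem hasSum_pow_mul_simpleWalkProb {p : ℝ} (hp : |p| < 1) (m : ℤ) :
    HasSum (fun k => p ^ k * simpleWalkProb k m)
      ((p / (1 + √(1 - p ^ 2))) ^ m.natAbs / √(1 - p ^ 2)) := by
  have hpos : 0 < 1 - p ^ 2 := by
    rw [← sq_abs]; nlinarith [abs_nonneg p]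
  set s := √(1 - p ^ 2) with hs
  have hs0 : 0 < s := Real.sqrt_pos.2 hpos
  have hs2 : s ^ 2 = 1 - p ^ 2 := Real.sq_sqrt hpos.le
  set r := p / (1 + s) with hr
  have hrs : r * (1 + s) = p := div_mul_cancel₀ _ (by positivity)
  have hpr : p * r = 1 - s := by
    have : (1 + s) * (p * r) = (1 + s) * (1 - s) := by linear_combination p * hrs + hs2
    exact mul_left_cancel₀ (by positivity) this
  have hr1 : |r| ≤ 1 := by
    rw [hr, abs_div, abs_of_pos (by positivity : 0 < 1 + s), div_le_one (by positivity)]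
    linarith
  -- The series `G` and the closed form `H` are bounded solutions of the same recurrence with a unit
  -- source at `0`, hence equal.
  set G : ℤ → ℝ := fun m => ∑' k, p ^ k * simpleWalkProb k m with hG
  have hsum := fun m => summable_pow_mul_simpleWalkProb hp m
  have hGrec : ∀ m, G m = (if m = 0 then 1 else 0) + p / 2 * (G (m - 1) + G (m + 1)) := by
    intro m
    simp only [hG]
    rw [(hsum m).tsum_eq_zero_add, ← (hsum _).tsum_add (hsum _), ← tsum_mul_left]
    congr 1
    · simp [simpleWalkProb]
    · refine tsum_congr fun k => ?_
      simp only [simpleWalkProb]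
      ring
  have hGB : ∀ m, |G m| ≤ (1 - |p|)⁻¹ := by
    intro m
    rw [← tsum_geometric_of_lt_one (abs_nonneg p) hp]
    rw [← Real.norm_eq_abs]
    refine tsum_of_norm_bounded (summable_geometric_of_lt_one (abs_nonneg p) hp).hasSum fun k => ?_
    rw [norm_mul, norm_pow, Real.norm_eq_abs, Real.norm_of_nonneg (simpleWalkProb_nonneg k m)]
    exact mul_le_of_le_one_right (by positivity) (simpleWalkProb_le_one k m)
  set H : ℤ → ℝ := fun m => r ^ m.natAbs / s with hH
  have hHB : ∀ m, |H m| ≤ 1 / s := by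
    intro m
    simp only [hH]
    rw [abs_div, abs_pow, abs_of_pos hs0]
    gcongr
    exact pow_le_one₀ (abs_nonneg r) hr1
  -- `r` is a root of `p (1 + r²) = 2 r`, the characteristic equation of the recurrence.
  have hstep : ∀ j : ℕ, p / 2 * (r ^ j + r ^ (j + 2)) = r ^ (j + 1) := by
    intro j
    linear_combination (r ^ j / 2 * r) * hpr + (- r ^ j / 2) * hrs
  have hHrec : ∀ m, H m = (if m = 0 then 1 else 0) + p / 2 * (H (m - 1) + H (m + 1)) := by
    intro m
    rcases lt_trichotomy m 0 with h | h | h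
    · obtain ⟨j, hj1, hj2, hj3⟩ : ∃ j : ℕ, m.natAbs = j + 1 ∧ (m - 1).natAbs = j + 2 ∧
        (m + 1).natAbs = j := ⟨(m + 1).natAbs, by omega, by omega, rfl⟩
      simp only [hH, hj1, hj2, hj3, if_neg h.ne]
      rw [← hstep j]; ring
    · subst h
      simp only [hH]
      rw [if_pos trivial, show (0 - 1 : ℤ).natAbs = 1 from rfl, show (0 + 1 : ℤ).natAbs = 1 from rfl,
        show (0 : ℤ).natAbs = 0 from rfl, div_eq_iff hs0.ne', add_mul, mul_assoc, add_mul,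
        div_mul_cancel₀ _ hs0.ne']
      linear_combination -hpr
    · obtain ⟨j, hj1, hj2, hj3⟩ : ∃ j : ℕ, m.natAbs = j + 1 ∧ (m - 1).natAbs = j ∧
        (m + 1).natAbs = j + 2 := ⟨(m - 1).natAbs, by omega, rfl, by omega⟩
      simp only [hH, hj1, hj2, hj3, if_neg h.ne']
      rw [← hstep j]; ring
  have hD := eq_zero_of_bounded_of_recurrence hp (D := fun m => G m - H m)
    (fun m => (abs_sub _ _).trans (add_le_add (hGB m) (hHB m)))
    (fun m => by rw [hGrec m, hHrec m]; ring) m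
  have : G m = H m := sub_eq_zero.1 hD
  exact (hsum m).hasSum_iff.2 this

/-- The solution `z` of `cosh z * p = 1` in the right half plane, for real `p`. -/
theorem exp_neg_and_tanh_of_cosh_mul_eq_one {p : ℝ} (hp0 : p ≠ 0) (hp : |p| < 1) {z : ℂ}
    (hz : 0 ≤ z.re) (h : Complex.cosh z * p = 1) :
    Complex.exp (-z) = ((p / (1 + √(1 - p ^ 2)) : ℝ) : ℂ) ∧
      Complex.tanh z = ((√(1 - p ^ 2) : ℝ) : ℂ) := by
  have hpos : 0 < 1 - p ^ 2 := by
    rw [← sq_abs]; nlinarith [abs_nonneg p]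
  set s := √(1 - p ^ 2) with hs
  have hs0 : 0 < s := Real.sqrt_pos.2 hpos
  have hs2 : (s : ℂ) ^ 2 = 1 - (p : ℂ) ^ 2 := by exact_mod_cast Real.sq_sqrt hpos.le
  have hpC : (p : ℂ) ≠ 0 := by exact_mod_cast hp0
  have hsC : (1 + s : ℂ) ≠ 0 := by exact_mod_cast (by positivity : 1 + s ≠ 0)
  set w := Complex.exp (-z) with hw
  have hw0 : w ≠ 0 := Complex.exp_ne_zero _
  have hwv : Complex.exp z * w = 1 := by rw [hw, ← Complex.exp_add]; simp
  have hw1 : ‖w‖ ≤ 1 := by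
    rw [hw, Complex.norm_exp, Complex.neg_re]
    exact Real.exp_le_one_iff.2 (by linarith)
  have h1 : (Complex.exp z + w) * p = 2 := by
    rw [Complex.cosh, ← hw] at h
    linear_combination 2 * h
  -- `p w` is a root of `X² - 2X + p² = 0`, whose roots are `1 ± s`. The root `1 + s` is excluded by
  -- `|p w| ≤ |p| < 1`, which uses `0 ≤ z.re`.
  have h2 : (p * w - 1 - s) * (p * w - 1 + s) = 0 := by
    linear_combination (p * w) * h1 - p ^ 2 * hwv - hs2
  have h3 : p * w = 1 - s := by
    rcases mul_eq_zero.1 h2 with h2 | h2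
    · exfalso
      have h4 : (p : ℂ) * w = ((1 + s : ℝ) : ℂ) := by push_cast; linear_combination h2
      have h5 := congrArg norm h4
      rw [norm_mul, Complex.norm_real, Complex.norm_real, Real.norm_eq_abs,
        Real.norm_of_nonneg (by positivity)] at h5
      nlinarith [abs_nonneg p, norm_nonneg w]
    · linear_combination h2
  have h4 : w * (1 + s) = p := by
    refine mul_left_cancel₀ hpC ?_
    linear_combination (1 + (s : ℂ)) * h3 - hs2
  refine ⟨?_, ?_⟩
  · push_cast
    rw [eq_div_iff hsC, h4]
  · rw [Complex.tanh_eq_sinh_div_cosh, div_eq_iff, Complex.sinh, ← hw]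
    · refine mul_left_cancel₀ hpC ?_
      have h6 : p * Complex.exp z = 1 + s := by linear_combination h1 - h3
      linear_combination (h6 - h3) / 2 - s * h
    · intro h0
      simp [h0] at h

/-! ### Summation under the integral over the cube -/

/-- By Tonelli, the integral of `‖f‖` is at most the sum of the integrals of the `‖F i‖`. Points
where the norms are not summable do no harm, the bound there being `∞`. -/
theorem integrable_of_hasSum_of_summable_integral_norm {α ι E : Type*} [Countable ι]
    {m : MeasurableSpace α} {μ : Measure α} [NormedAddCommGroup E] {F : ι → α → E} {f : α → E}
    (hF : ∀ i, Integrable (F i) μ) (hs : Summable fun i => ∫ a, ‖F i a‖ ∂μ)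
    (hf : AEStronglyMeasurable f μ) (h : ∀ᵐ a ∂μ, HasSum (fun i => F i a) (f a)) :
    Integrable f μ := by
  refine ⟨hf, ?_⟩
  have hle : ∫⁻ a, ‖f a‖ₑ ∂μ ≤ ∑' i, ∫⁻ a, ‖F i a‖ₑ ∂μ := by
    rw [← lintegral_tsum fun i => (hF i).1.enorm]
    refine lintegral_mono_ae ?_
    filter_upwards [h] with a ha
    by_cases hn : Summable fun i => ‖F i a‖₊
    · rw [← ha.tsum_eq]
      simp only [enorm_eq_nnnorm]
      rw [← ENNReal.coe_tsum hn, ENNReal.coe_le_coe]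
      exact nnnorm_tsum_le hn
    · simp only [enorm_eq_nnnorm]
      rw [ENNReal.tsum_coe_eq_top_iff_not_summable_coe.2 (by exact_mod_cast hn)]
      exact le_top
  refine lt_of_le_of_lt hle ?_
  have he : ∀ i, ∫⁻ a, ‖F i a‖ₑ ∂μ = ENNReal.ofReal (∫ a, ‖F i a‖ ∂μ) := fun i =>
    (ofReal_integral_norm_eq_lintegral_enorm (hF i)).symm
  simp_rw [he]
  rw [← ENNReal.ofReal_tsum_of_nonneg (fun i => integral_nonneg fun a => norm_nonneg _) hs]
  exact ENNReal.ofReal_lt_top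

theorem measurableSet_piCube (d : ℕ) : MeasurableSet (piCube d) := measurableSet_Icc

theorem volume_restrict_piCube (d : ℕ) :
    (volume : Measure (Fin d → ℝ)).restrict (piCube d) =
      Measure.pi fun _ => volume.restrict (Set.Icc 0 Real.pi) := by
  rw [piCube, ← Set.pi_univ_Icc, volume_pi, Measure.restrict_pi_pi]
  rfl

theorem integral_Icc_zero_pi (f : ℝ → ℝ) :
    ∫ t in Set.Icc 0 Real.pi, f t = ∫ t in (0 : ℝ)..Real.pi, f t := by
  rw [integral_Icc_eq_integral_Ioc, intervalIntegral.integral_of_le Real.pi_pos.le]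

/-- The contribution of time `k` to the integrand, before the last coordinate is summed out. -/
noncomputable def visitTerm {d : ℕ} (u : Fin (d + 1) → ℤ) (k : ℕ) (x : Fin d → ℝ) : ℝ :=
  (∏ j, Real.cos (x j) ^ k * Real.cos (u j.castSucc * x j)) * simpleWalkProb k (u (Fin.last d))

theorem integrableOn_visitTerm {d : ℕ} (u : Fin (d + 1) → ℤ) (k : ℕ) :
    IntegrableOn (visitTerm u k) (piCube d) := by
  refine ContinuousOn.integrableOn_compact isCompact_Icc (Continuous.continuousOn ?_)
  unfold visitTerm
  fun_prop

theorem integral_visitTerm {d : ℕ} (u : Fin (d + 1) → ℤ) (k : ℕ) :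
    ∫ x in piCube d, visitTerm u k x = Real.pi ^ d * ∏ j, simpleWalkProb k (u j) := by
  simp only [visitTerm]
  rw [integral_mul_const, volume_restrict_piCube,
    integral_fintype_prod_eq_prod (fun (j : Fin d) t => Real.cos t ^ k * Real.cos (u j.castSucc * t))]
  simp_rw [integral_Icc_zero_pi, integral_cos_pow_mul_cos]
  rw [Finset.prod_mul_distrib, Fin.prod_univ_castSucc]
  simp [mul_assoc]

/-- The `d` cosine integrals and the probability kept for the last coordinate each give one factor
`absCosMoment k`. -/
theorem integral_norm_visitTerm_le {d : ℕ} (u : Fin (d + 1) → ℤ) (k : ℕ) :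
    ∫ x in piCube d, ‖visitTerm u k x‖ ≤ Real.pi ^ d * absCosMoment k ^ (d + 1) := by
  simp only [visitTerm, norm_mul, norm_prod]
  rw [integral_mul_const, volume_restrict_piCube]
  simp only [← norm_mul]
  rw [integral_fintype_prod_eq_prod
    (fun (j : Fin d) t => ‖Real.cos t ^ k * Real.cos (u j.castSucc * t)‖)]
  simp_rw [integral_Icc_zero_pi, Real.norm_eq_abs]
  rw [abs_of_nonneg (simpleWalkProb_nonneg _ _), pow_succ, ← mul_assoc, ← mul_pow]
  refine mul_le_mul ?_ (simpleWalkProb_le_absCosMoment _ _) (simpleWalkProb_nonneg _ _)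
    (pow_nonneg (mul_nonneg Real.pi_pos.le (absCosMoment_nonneg k)) _)
  calc _ ≤ ∏ _j : Fin d, Real.pi * absCosMoment k :=
        Finset.prod_le_prod
          (fun j _ => intervalIntegral.integral_nonneg Real.pi_pos.le fun _ _ => abs_nonneg _)
          fun j _ => integral_abs_cos_pow_mul_cos_le k _
    _ = _ := by simp

theorem summable_integral_norm_visitTerm {d : ℕ} (hn : 3 < d + 1) (u : Fin (d + 1) → ℤ) :
    Summable fun k => ∫ x in piCube d, ‖visitTerm u k x‖ :=
  Summable.of_nonneg_of_le (fun _ => integral_nonneg fun _ => norm_nonneg _)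
    (fun k => integral_norm_visitTerm_le u k) ((summable_absCosMoment_pow hn).mul_left _)

/-- The real form of `visitIntegrand`, in which `λ_n` is eliminated. -/
noncomputable def realVisitIntegrand {d : ℕ} (u : Fin (d + 1) → ℤ) (x : Fin d → ℝ) : ℝ :=
  (∏ j, Real.cos (u j.castSucc * x j)) *
    (((∏ j, Real.cos (x j)) / (1 + √(1 - (∏ j, Real.cos (x j)) ^ 2))) ^ (u (Fin.last d)).natAbs /
      √(1 - (∏ j, Real.cos (x j)) ^ 2))

theorem measurable_realVisitIntegrand {d : ℕ} (u : Fin (d + 1) → ℤ) :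
    Measurable (realVisitIntegrand u) := by
  unfold realVisitIntegrand
  fun_prop

theorem abs_prod_cos_lt_one {d : ℕ} {x : Fin d → ℝ} {j : Fin d} (hx : |Real.cos (x j)| < 1) :
    |∏ j, Real.cos (x j)| < 1 := by
  rw [Finset.abs_prod, ← Finset.mul_prod_erase _ _ (Finset.mem_univ j)]
  refine lt_of_le_of_lt (mul_le_of_le_one_right (abs_nonneg _) ?_) hx
  exact Finset.prod_le_one (fun _ _ => abs_nonneg _) fun _ _ => Real.abs_cos_le_one _

theorem abs_cos_lt_one_of_pos_of_lt_pi {t : ℝ} (h0 : 0 < t) (h1 : t < Real.pi) : |Real.cos t| < 1 := by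
  rw [← sq_lt_one_iff_abs_lt_one]
  nlinarith [Real.sin_sq_add_cos_sq t, Real.sin_pos_of_pos_of_lt_pi h0 h1]

theorem cos_ne_zero_of_ne_pi_div_two {t : ℝ} (h0 : 0 ≤ t) (h1 : t ≤ Real.pi) (h : t ≠ Real.pi / 2) :
    Real.cos t ≠ 0 := by
  intro hc
  refine h (Real.injOn_cos ⟨h0, h1⟩ ⟨by positivity, by linarith [Real.pi_pos]⟩ ?_)
  rw [hc, Real.cos_pi_div_two]

/-- The exceptional points have a coordinate in `{0, π/2, π}`, so they lie on finitely many null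
hyperplanes. For `d = 0` the empty product is 1 and the strict bound fails. -/
theorem ae_prod_cos {d : ℕ} (hd : 0 < d) :
    ∀ᵐ x ∂(volume : Measure (Fin d → ℝ)).restrict (piCube d), x ∈ piCube d ∧
      ∏ j, Real.cos (x j) ≠ 0 ∧ |∏ j, Real.cos (x j)| < 1 := by
  have hne : ∀ a : ℝ, ∀ᵐ x ∂(volume : Measure (Fin d → ℝ)), ∀ j, x j ≠ a := fun a =>
    ae_all_iff.2 fun j => by rw [volume_pi]; exact Measure.ae_eval_ne (α := fun _ => ℝ) _ j a
  rw [ae_restrict_iff' (measurableSet_piCube d)]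
  filter_upwards [hne 0, hne Real.pi, hne (Real.pi / 2)] with x h0 h1 h2 hx
  have hx0 : ∀ j, 0 ≤ x j := fun j => hx.1 j
  have hx1 : ∀ j, x j ≤ Real.pi := fun j => hx.2 j
  refine ⟨hx, Finset.prod_ne_zero_iff.2 fun j _ => cos_ne_zero_of_ne_pi_div_two (hx0 j) (hx1 j) (h2 j),
    abs_prod_cos_lt_one (j := ⟨0, hd⟩) (abs_cos_lt_one_of_pos_of_lt_pi ?_ ?_)⟩
  · exact lt_of_le_of_ne (hx0 _) (h0 _).symm
  · exact lt_of_le_of_ne (hx1 _) (h1 _)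

theorem hasSum_visitTerm {d : ℕ} (u : Fin (d + 1) → ℤ) {x : Fin d → ℝ}
    (hx : |∏ j, Real.cos (x j)| < 1) :
    HasSum (fun k => visitTerm u k x) (realVisitIntegrand u x) := by
  refine ((hasSum_pow_mul_simpleWalkProb hx (u (Fin.last d))).mul_left
    (∏ j, Real.cos (u (Fin.castSucc j) * x j))).congr_fun ?_
  intro k
  simp only [visitTerm]
  rw [Finset.prod_mul_distrib, Finset.prod_pow]
  ring

theorem integrableOn_realVisitIntegrand {d : ℕ} (hn : 3 < d + 1) (u : Fin (d + 1) → ℤ) :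
    IntegrableOn (realVisitIntegrand u) (piCube d) := by
  refine integrable_of_hasSum_of_summable_integral_norm (integrableOn_visitTerm u)
    (summable_integral_norm_visitTerm hn u) (measurable_realVisitIntegrand u).aestronglyMeasurable ?_
  filter_upwards [ae_prod_cos (by omega : 0 < d)] with x hx using hasSum_visitTerm u hx.2.2

theorem hasSum_prod_simpleWalkProb {d : ℕ} (hn : 3 < d + 1) (u : Fin (d + 1) → ℤ) :
    HasSum (fun k => ∏ j, simpleWalkProb k (u j))
      (1 / Real.pi ^ d * ∫ x in piCube d, realVisitIntegrand u x) := by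
  have h := (hasSum_integral_of_summable_integral_norm (integrableOn_visitTerm u)
    (summable_integral_norm_visitTerm hn u)).mul_left (1 / Real.pi ^ d)
  have he : ∫ x in piCube d, ∑' k, visitTerm u k x = ∫ x in piCube d, realVisitIntegrand u x := by
    refine integral_congr_ae ?_
    filter_upwards [ae_prod_cos (by omega : 0 < d)] with x hx using
      (hasSum_visitTerm u hx.2.2).tsum_eq
  rw [he] at h
  refine h.congr_fun fun k => ?_
  rw [integral_visitTerm, one_div, inv_mul_cancel_left₀ (pow_ne_zero _ Real.pi_ne_zero)]

theorem visitIntegrand_ae_eq {d : ℕ} (hd : 0 < d) {Λ : (Fin d → ℝ) → ℂ}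
    (hΛ : IsDispersionSolution d Λ) (u : Fin (d + 1) → ℤ) :
    visitIntegrand Λ u =ᵐ[volume.restrict (piCube d)] fun x => (realVisitIntegrand u x : ℂ) := by
  filter_upwards [ae_prod_cos hd] with x ⟨hx, h0, h1⟩
  obtain ⟨hre, hcosh⟩ := hΛ x hx h0
  obtain ⟨he, ht⟩ := exp_neg_and_tanh_of_cosh_mul_eq_one h0 h1 hre (by push_cast; exact hcosh)
  -- Since `|u_n|` is an integer, only `exp (-Λ x)` matters, and the choice of branch of `Λ` drops
  -- out.
  have hexp : Complex.exp (-(|u (Fin.last d)| : ℤ) * Λ x) =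
      Complex.exp (-Λ x) ^ (u (Fin.last d)).natAbs := by
    rw [← Complex.exp_nat_mul]
    congr 1
    rw [Int.abs_eq_natAbs, Int.cast_natCast]
    ring
  rw [visitIntegrand, hexp, he, ht, realVisitIntegrand]
  push_cast
  ring

theorem visitIntegrand_zero {d : ℕ} (Λ : (Fin d → ℝ) → ℂ) (x : Fin d → ℝ) :
    visitIntegrand Λ 0 x = 1 / Complex.tanh (Λ x) := by
  simp [visitIntegrand]

/-! ### The law of the walk at a fixed time -/

theorem card_diagonalSteps (n : ℕ) : (diagonalSteps n).card = 2 ^ n := by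
  simp [diagonalSteps]

theorem sum_diagonalSteps_prod {n : ℕ} (f : Fin n → ℤ → ℝ) :
    ∑ v ∈ diagonalSteps n, ∏ j, f j (v j) = ∏ j, (f j (-1) + f j 1) := by
  rw [diagonalSteps, ← Finset.prod_univ_sum]
  simp

theorem measureReal_uniformOn_diagonalSteps_singleton {n : ℕ} {v : Fin n → ℤ}
    (hv : v ∈ diagonalSteps n) :
    (uniformOn (diagonalSteps n : Set (Fin n → ℤ))).real {v} = 1 / 2 ^ n := by
  rw [measureReal_def, ← Finset.coe_singleton, uniformOn_apply_finset,
    Finset.inter_singleton_of_mem hv, card_diagonalSteps]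
  simp

/-- Conditioning on the last step averages a product over all sign vectors; by distributivity this
average factors into the one-dimensional recurrences. -/
theorem measureReal_sum_range_eq {Ω : Type*} [MeasurableSpace Ω] {μ : Measure Ω}
    [IsProbabilityMeasure μ] {n : ℕ}
    {X : ℕ → Ω → Fin n → ℤ} (hX : ∀ i, Measurable (X i))
    (hi : iIndepFun X μ)
    (hl : ∀ i, μ.map (X i) = uniformOn (diagonalSteps n : Set (Fin n → ℤ)))
    (k : ℕ) (u : Fin n → ℤ) :
    μ.real {ω | ∑ i ∈ Finset.range k, X i ω = u} = ∏ j, simpleWalkProb k (u j) := by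
  induction k generalizing u with
  | zero =>
    by_cases h : u = 0
    · subst h
      simp [simpleWalkProb]
    · obtain ⟨j, hj⟩ := Function.ne_iff.1 h
      have : {ω : Ω | ∑ i ∈ Finset.range 0, X i ω = u} = ∅ := by
        ext ω; simpa using Ne.symm h
      rw [this, measureReal_empty, eq_comm]
      exact Finset.prod_eq_zero (Finset.mem_univ j) (by simpa [simpleWalkProb] using hj)
  | succ k ih =>
    have hW : Measurable fun ω => ∑ i ∈ Finset.range k, X i ω :=
      Finset.measurable_fun_sum _ fun i _ => hX i
    have hmem : ∀ᵐ ω ∂μ, X k ω ∈ diagonalSteps n := by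
      have h : ∀ᵐ v ∂(μ.map (X k)), v ∈ (diagonalSteps n : Set (Fin n → ℤ)) := by
        rw [hl k, uniformOn]
        exact ae_cond_mem (diagonalSteps n).measurableSet
      exact ae_of_ae_map (hX k).aemeasurable h
    have hae : {ω | ∑ i ∈ Finset.range (k + 1), X i ω = u} =ᵐ[μ]
        ⋃ v ∈ diagonalSteps n, {ω | ∑ i ∈ Finset.range k, X i ω = u - v} ∩ {ω | X k ω = v} := by
      refine Filter.eventuallyEq_set.2 ?_
      filter_upwards [hmem] with ω hω
      simp only [Set.mem_ofPred_eq, Set.mem_iUnion, Set.mem_inter_iff, Finset.sum_range_succ]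
      constructor
      · intro h
        exact ⟨X k ω, hω, eq_sub_of_add_eq h, rfl⟩
      · rintro ⟨v, -, h1, h2⟩
        rw [h1, h2, sub_add_cancel]
    have hm1 : ∀ v, MeasurableSet {ω | ∑ i ∈ Finset.range k, X i ω = v} := fun v =>
      hW (measurableSet_singleton v)
    have hm2 : ∀ v, MeasurableSet {ω | X k ω = v} := fun v => hX k (measurableSet_singleton v)
    rw [measureReal_congr hae, measureReal_biUnion_finset]
    · have hind : IndepFun (fun ω => ∑ i ∈ Finset.range k, X i ω) (X k) μ := by
        convert hi.indepFun_sum_range_succ hX k using 1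
        ext ω : 1
        simp
      have hterm : ∀ v ∈ diagonalSteps n,
          μ.real ({ω | ∑ i ∈ Finset.range k, X i ω = u - v} ∩ {ω | X k ω = v}) =
            1 / 2 ^ n * ∏ j, simpleWalkProb k (u j - v j) := by
        intro v hv
        have h1 := hind.measure_inter_preimage_eq_mul {u - v} {v} (measurableSet_singleton _)
          (measurableSet_singleton _)
        have h2 : μ.real {ω | X k ω = v} = 1 / 2 ^ n := by
          rw [← measureReal_uniformOn_diagonalSteps_singleton hv, ← hl k,
            map_measureReal_apply (hX k) (measurableSet_singleton v)]
          rfl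
        have h3 := congrArg ENNReal.toReal h1
        rw [ENNReal.toReal_mul] at h3
        refine h3.trans ?_
        rw [mul_comm]
        exact congrArg₂ (· * ·) h2 (ih (u - v))
      rw [Finset.sum_congr rfl hterm, ← Finset.mul_sum,
        sum_diagonalSteps_prod (fun j z => simpleWalkProb k (u j - z))]
      simp only [simpleWalkProb]
      rw [Finset.prod_div_distrib]
      simp only [Finset.prod_const, Finset.card_univ, Fintype.card_fin, sub_neg_eq_add]
      rw [one_div_mul_eq_div]
      congr 1
      exact Finset.prod_congr rfl fun j _ => add_comm _ _
    · intro v _ w _ hvw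
      refine Set.disjoint_left.2 fun ω h1 h2 => hvw ?_
      exact h1.2.symm.trans h2.2
    · exact fun v _ => (hm1 _).inter (hm2 _)

/-! ### Renewal at the last visit to the origin -/

theorem measurableSet_forall_sum_range_ne_zero {E : Type*} [AddCommMonoid E] [MeasurableSpace E]
    [MeasurableSingletonClass E] [MeasurableAdd₂ E]
    {α : Type*} [MeasurableSpace α] {X : ℕ → α → E}
    (hX : ∀ i, Measurable (X i)) :
    MeasurableSet {ω | ∀ j, 1 ≤ j → ∑ i ∈ Finset.range j, X i ω ≠ 0} := by
  simp only [Set.ofPred_forall]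
  refine MeasurableSet.iInter fun j => MeasurableSet.iInter fun _ => ?_
  exact ((Finset.measurable_fun_sum _ fun i _ => hX i) (measurableSet_singleton 0)).compl

/-- Both sequences have as law the infinite product of one and the same marginal. -/
theorem map_shift_eq {Ω : Type*} [MeasurableSpace Ω] {μ : Measure Ω}
    {E : Type*} [MeasurableSpace E] {X : ℕ → Ω → E} (hX : ∀ i, Measurable (X i)) (hi : iIndepFun X μ)
    (hl : ∀ i, μ.map (X i) = μ.map (X 0)) (k : ℕ) :
    μ.map (fun ω i => X (k + i) ω) = μ.map (fun ω i => X i ω) := by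
  rw [hi.map_fun_eq_infinitePi_map hX,
    (hi.precomp (add_right_injective k)).map_fun_eq_infinitePi_map fun i => hX (k + i)]
  congr 1
  funext i
  rw [hl i, ← hl (k + i)]

theorem measure_avoid_shift {Ω : Type*} [MeasurableSpace Ω] {μ : Measure Ω}
    {E : Type*} [AddCommMonoid E] [MeasurableSpace E]
    [MeasurableSingletonClass E] [MeasurableAdd₂ E]
    {X : ℕ → Ω → E} (hX : ∀ i, Measurable (X i)) (hi : iIndepFun X μ)
    (hl : ∀ i, μ.map (X i) = μ.map (X 0)) (k : ℕ) :
    μ {ω | ∀ j, 1 ≤ j → ∑ i ∈ Finset.range j, X (k + i) ω ≠ 0} =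
      μ {ω | ∀ j, 1 ≤ j → ∑ i ∈ Finset.range j, X i ω ≠ 0} := by
  have hB : MeasurableSet {f : ℕ → E | ∀ j, 1 ≤ j → ∑ i ∈ Finset.range j, f i ≠ 0} :=
    measurableSet_forall_sum_range_ne_zero (X := fun i (f : ℕ → E) => f i)
      fun i => measurable_pi_apply i
  have h := congrArg (fun ρ => ρ {f : ℕ → E | ∀ j, 1 ≤ j → ∑ i ∈ Finset.range j, f i ≠ 0})
    (map_shift_eq hX hi hl k)
  rwa [Measure.map_apply (measurable_pi_lambda _ fun i => hX (k + i)) hB,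
    Measure.map_apply (measurable_pi_lambda _ fun i => hX i) hB] at h

/-- The two events depend on the disjoint blocks of increments with index `< k` and `≥ k`. -/
theorem measure_sum_range_eq_zero_inter_avoid {Ω : Type*} [MeasurableSpace Ω] {μ : Measure Ω}
    {E : Type*} [AddCommMonoid E] [MeasurableSpace E]
    [MeasurableSingletonClass E] [MeasurableAdd₂ E]
    {X : ℕ → Ω → E} (hX : ∀ i, Measurable (X i))
    (hi : iIndepFun X μ) (k : ℕ) :
    μ ({ω | ∑ i ∈ Finset.range k, X i ω = 0} ∩
        {ω | ∀ j, 1 ≤ j → ∑ i ∈ Finset.range j, X (k + i) ω ≠ 0}) =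
      μ {ω | ∑ i ∈ Finset.range k, X i ω = 0} *
        μ {ω | ∀ j, 1 ≤ j → ∑ i ∈ Finset.range j, X (k + i) ω ≠ 0} := by
  have hind := indep_iSup_of_disjoint (fun i => (hX i).comap_le) hi
    (S := Set.Iio k) (T := Set.Ici k)
    (Set.disjoint_left.2 fun i h1 h2 => not_lt.2 (Set.mem_Ici.1 h2) h1)
  refine (Indep_iff _ _ μ).1 hind _ _ ?_ ?_
  · have hm : ∀ i ∈ Finset.range k,
        Measurable[⨆ i ∈ Set.Iio k, MeasurableSpace.comap (X i) inferInstance] (X i) :=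
      fun i h => (comap_measurable (X i)).mono
        (le_iSup₂_of_le i (Finset.mem_range.1 h) le_rfl) le_rfl
    exact (Finset.measurable_fun_sum _ hm) (measurableSet_singleton 0)
  · refine @measurableSet_forall_sum_range_ne_zero _ _ _ _ _ _ (_) (fun i => X (k + i)) fun i => ?_
    exact (comap_measurable (X (k + i))).mono
      (le_iSup₂_of_le (k + i) (Set.mem_Ici.2 (Nat.le_add_right k i)) le_rfl) le_rfl

/-- Decomposition of the sample space by the time of the last visit to the origin. -/
theorem tsum_measure_mul_measure_avoid_eq_one {Ω : Type*} [MeasurableSpace Ω] {μ : Measure Ω}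
    [IsProbabilityMeasure μ]
    {E : Type*} [AddCommGroup E] [MeasurableSpace E] [MeasurableSingletonClass E]
    [MeasurableAdd₂ E] {X : ℕ → Ω → E} (hX : ∀ i, Measurable (X i))
    (hi : iIndepFun X μ) (hl : ∀ i, μ.map (X i) = μ.map (X 0))
    (hfin : ∑' k, μ {ω | ∑ i ∈ Finset.range k, X i ω = 0} ≠ ∞) :
    (∑' k, μ {ω | ∑ i ∈ Finset.range k, X i ω = 0}) *
      μ {ω | ∀ j, 1 ≤ j → ∑ i ∈ Finset.range j, X i ω ≠ 0} = 1 := by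
  have hadd : ∀ k j ω, ∑ i ∈ Finset.range (k + j), X i ω =
      ∑ i ∈ Finset.range k, X i ω + ∑ i ∈ Finset.range j, X (k + i) ω := fun k j ω =>
    Finset.sum_range_add (fun i => X i ω) k j
  set L : ℕ → Set Ω := fun k => {ω | ∑ i ∈ Finset.range k, X i ω = 0} ∩
    {ω | ∀ j, 1 ≤ j → ∑ i ∈ Finset.range j, X (k + i) ω ≠ 0} with hL
  have hLm : ∀ k, MeasurableSet (L k) := fun k =>
    ((Finset.measurable_fun_sum _ fun i _ => hX i) (measurableSet_singleton 0)).inter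
      (measurableSet_forall_sum_range_ne_zero fun i => hX (k + i))
  have hlt : ∀ k l ω, k < l → ω ∈ L k → ω ∉ L l := by
    intro k l ω hkl h1 h2
    obtain ⟨j, rfl⟩ := Nat.exists_eq_add_of_lt hkl
    refine h1.2 (j + 1) (by omega) ?_
    have h3 : ∑ i ∈ Finset.range (k + (j + 1)), X i ω = 0 := h2.1
    rw [hadd] at h3
    rwa [show ∑ i ∈ Finset.range k, X i ω = 0 from h1.1, zero_add] at h3
  have hdis : Pairwise (Function.onFun Disjoint L) := by
    intro k l hkl
    refine Set.disjoint_left.2 fun ω h1 h2 => ?_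
    rcases lt_or_gt_of_ne hkl with h | h
    · exact hlt k l ω h h1 h2
    · exact hlt l k ω h h2 h1
  have hcover : ∀ᵐ ω ∂μ, ω ∈ ⋃ k, L k := by
    -- Borel–Cantelli: almost surely there are no visits from some time `N` on.
    filter_upwards [ae_eventually_notMem hfin] with ω hω
    obtain ⟨N, hN⟩ := Filter.eventually_atTop.1 hω
    classical
    have h0 : ∑ i ∈ Finset.range 0, X i ω = 0 := by simp
    -- The last visit is the greatest one up to `N`; the visit at time 0 ensures that `findGreatest`
    -- returns a genuine visit.
    have hs := Nat.findGreatest_spec (P := fun k => ∑ i ∈ Finset.range k, X i ω = 0)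
      (Nat.zero_le N) h0
    refine Set.mem_iUnion.2 ⟨_, hs, fun j hj hj0 => ?_⟩
    set K := Nat.findGreatest (fun k => ∑ i ∈ Finset.range k, X i ω = 0) N with hK
    have h1 : ∑ i ∈ Finset.range (K + j), X i ω = 0 := by
      rw [hadd, hj0, add_zero]; exact hs
    rcases le_or_gt (K + j) N with h | h
    · have := Nat.le_findGreatest (P := fun k => ∑ i ∈ Finset.range k, X i ω = 0) h h1
      omega
    · exact hN _ h.le h1
  rw [← ENNReal.tsum_mul_right, ← prob_compl_eq_zero_iff (MeasurableSet.iUnion hLm) |>.1 hcover,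
    measure_iUnion hdis hLm]
  refine tsum_congr fun k => ?_
  rw [hL, measure_sum_range_eq_zero_inter_avoid hX hi k, measure_avoid_shift hX hi hl k]

/-! ### From the walk to its increments, and the main theorem -/

/-- The increments are only almost everywhere measurable; measurable versions differ from them on
countably many null sets, so one null set serves all times. -/
theorem IsDiagonalWalk.exists_increments {Ω : Type*} [MeasurableSpace Ω] {n : ℕ} {μ : Measure Ω}
    {S : ℕ → Ω → Fin n → ℤ} (hS : IsDiagonalWalk n μ S) :
    ∃ X : ℕ → Ω → Fin n → ℤ, (∀ i, Measurable (X i)) ∧ iIndepFun X μ ∧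
      (∀ i, μ.map (X i) = uniformOn (diagonalSteps n : Set (Fin n → ℤ))) ∧
      ∀ᵐ ω ∂μ, ∀ k, S k ω = ∑ i ∈ Finset.range k, X i ω := by
  have hm := fun k => (hS.law k).aemeasurable
  refine ⟨fun k => (hm k).mk _, fun k => (hm k).measurable_mk,
    (iIndepFun_congr fun k => (hm k).ae_eq_mk).1 hS.indep, fun k => ?_, ?_⟩
  · rw [← (hS.law k).map_eq]
    exact Measure.map_congr (hm k).ae_eq_mk.symm
  · filter_upwards [hS.start, ae_all_iff.2 fun k => (hm k).ae_eq_mk] with ω h0 h k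
    induction k with
    | zero => simpa using h0
    | succ k ih => rw [Finset.sum_range_succ, ← ih, ← h k]; abel

theorem expectedVisits_eq_tsum {Ω : Type*} [MeasurableSpace Ω] {n : ℕ}
    {μ : Measure Ω} {S X : ℕ → Ω → Fin n → ℤ} (hX : ∀ i, Measurable (X i))
    (hSX : ∀ᵐ ω ∂μ, ∀ k, S k ω = ∑ i ∈ Finset.range k, X i ω) (u : Fin n → ℤ) :
    expectedVisits μ S u = ∑' k, μ {ω | ∑ i ∈ Finset.range k, X i ω = u} := by
  have hm : ∀ k, MeasurableSet {ω | ∑ i ∈ Finset.range k, X i ω = u} := fun k =>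
    (Finset.measurable_fun_sum _ fun i _ => hX i) (measurableSet_singleton u)
  have h : expectedVisits μ S u =
      ∫⁻ ω, ∑' k, {ω | ∑ i ∈ Finset.range k, X i ω = u}.indicator 1 ω ∂μ := by
    refine lintegral_congr_ae ?_
    filter_upwards [hSX] with ω hω
    refine tsum_congr fun k => ?_
    rw [hω k]
    simp [Set.indicator_apply]
  rw [h, lintegral_tsum fun k => (measurable_one.indicator (hm k)).aemeasurable]
  exact tsum_congr fun k => lintegral_indicator_one (hm k)

theorem mainTheorem8 (d : ℕ) (hn : 3 < d + 1)
    {Ω : Type*} [MeasurableSpace Ω] (μ : Measure Ω) [IsProbabilityMeasure μ]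
    (S : ℕ → Ω → Fin (d + 1) → ℤ) (hS : IsDiagonalWalk (d + 1) μ S)
    (Λ : (Fin d → ℝ) → ℂ) (hΛ : IsDispersionSolution d Λ) :
    (∀ u : Fin (d + 1) → ℤ,
      IntegrableOn (visitIntegrand Λ u) (piCube d) ∧
      expectedVisits μ S u ≠ ∞ ∧
      ((expectedVisits μ S u).toReal : ℂ) =
        1 / (Real.pi : ℂ) ^ d * ∫ x in piCube d, visitIntegrand Λ u x) ∧
    ∃ F : ℝ,
      F = (expectedVisits μ S 0).toReal ∧
      (F : ℂ) = 1 / (Real.pi : ℂ) ^ d * ∫ x in piCube d, 1 / Complex.tanh (Λ x) ∧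
      μ.real (returnEvent S) = 1 - 1 / F := by
  have hd : 0 < d := by omega
  obtain ⟨X, hX, hi, hl, hSX⟩ := hS.exists_increments
  have hvis : ∀ u, expectedVisits μ S u =
      ENNReal.ofReal (1 / Real.pi ^ d * ∫ x in piCube d, realVisitIntegrand u x) := by
    intro u
    have hs := hasSum_prod_simpleWalkProb hn u
    rw [expectedVisits_eq_tsum hX hSX, ← hs.tsum_eq,
      ENNReal.ofReal_tsum_of_nonneg (fun k => Finset.prod_nonneg fun j _ =>
        simpleWalkProb_nonneg _ _) hs.summable]
    refine tsum_congr fun k => ?_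
    rw [← measureReal_sum_range_eq hX hi hl k u, ofReal_measureReal]
  have hfin : ∀ u, expectedVisits μ S u ≠ ∞ := fun u => hvis u ▸ ENNReal.ofReal_ne_top
  have hmain : ∀ u, ((expectedVisits μ S u).toReal : ℂ) =
      1 / (Real.pi : ℂ) ^ d * ∫ x in piCube d, visitIntegrand Λ u x := by
    intro u
    rw [hvis, ENNReal.toReal_ofReal ((hasSum_prod_simpleWalkProb hn u).nonneg fun k =>
      Finset.prod_nonneg fun j _ => simpleWalkProb_nonneg _ _),
      integral_congr_ae (visitIntegrand_ae_eq hd hΛ u), integral_complex_ofReal]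
    push_cast
    rfl
  refine ⟨fun u => ⟨?_, hfin u, hmain u⟩, (expectedVisits μ S 0).toReal, rfl, ?_, ?_⟩
  · exact (integrableOn_realVisitIntegrand hn u).ofReal.congr (visitIntegrand_ae_eq hd hΛ u).symm
  · rw [hmain 0]
    simp_rw [visitIntegrand_zero]
  · have htsum := expectedVisits_eq_tsum hX hSX 0
    have hren := tsum_measure_mul_measure_avoid_eq_one hX hi (fun i => (hl i).trans (hl 0).symm)
      (htsum ▸ hfin 0)
    rw [← htsum] at hren
    set A : Set Ω := {ω | ∀ j, 1 ≤ j → ∑ i ∈ Finset.range j, X i ω ≠ 0} with hA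
    -- Up to a null set, return is the complement of the event `A`, whose probability is `1/F` by
    -- `hren`.
    have hret : returnEvent S =ᵐ[μ] (Aᶜ : Set Ω) := by
      refine Filter.eventuallyEq_set.2 ?_
      filter_upwards [hSX] with ω hω
      simp [returnEvent, hA, hω]
    have hr := congrArg ENNReal.toReal hren
    rw [ENNReal.toReal_mul, ENNReal.toReal_one] at hr
    rw [measureReal_congr hret,
      probReal_compl_eq_one_sub (measurableSet_forall_sum_range_ne_zero hX), measureReal_def,
      eq_one_div_of_mul_eq_one_right hr]
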